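/- A permutation of length $n$ is a word containing each of $1,\ldots,n$ exactly once; a permutation $\sigma$ contains a (consecutive) occurrence of a pattern $\pi\in S_r$ at position $i$ if $\sigma_i\sigma_{i+1}\cdots\sigma_{i+r-1}$ is in the same relative order as $\pi$. For $k\ge 1$, a $k$-cluster of $\pi$ is a permutation $\sigma$ (of any length) together with positions $i_1<\cdots<i_k$ at which $\pi$ occurs in $\sigma$, such that $i_1=1$, $i_{j+1}<i_j+r$ for $1\le j<k$, and $\sigma$ has length $i_k+r-1$. Let $\pi_{n,k}$ be the number of permutations of length $n$ with exactly $k$ occurrences of $\pi$, and put $\Pi(x,t)=\sum_{n,k\ge 0}\pi_{n,k}\frac{x^n}{n!}t^k$, a formal power series. Two patterns are equivalent if for all $n$ and all $0\le k<n$ they have the same number $\pi_{n,k}$. Let $1\le a<m$, and for a permutation (word) $\tau$ of the numbers $a+2,\ldots,m+1$ consider the pattern $\pi=12\ldots a\,\tau\,(a+1)\in S_{m+1}$. Then: 1. for every $k\ge 1$, the number of $k$-clusters of $\pi$ is $\prod_{j=1}^k\binom{jm-a}{m-a}$; 2. the multiplicative inverse of the generating function $\Pi(x,t)$ of $\pi$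 is $$1-x-\sum_{k\ge1}\frac{(t-1)^k x^{km+1}}{(km+1)!}\prod_{j=1}^k\binom{jm-a}{m-a};$$ 3. for fixed $a$ and $m$, all these patterns, for different $\tau$, are equivalent to each other. -/

import Mathlib

open scoped PowerSeries

/-- The sequence `s` of distinct numbers has standardization `p`: its entries are in the same
relative order as those of `p`. (Entries and positions are numbered from `0`.) -/
def StandardizesTo {r : ℕ} (s : Fin r → ℕ) (p : Equiv.Perm (Fin r)) : Prop :=
  ∀ u v : Fin r, s u < s v ↔ p u < p v

/-- The consecutive pattern `p` of length `r` occurs in the permutation `σ` of length `n` at the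
positions `i, i + 1, …, i + r - 1`. -/
def OccursAt {r n : ℕ} (p : Equiv.Perm (Fin r)) (σ : Equiv.Perm (Fin n)) (i : ℕ) : Prop :=
  ∃ h : i + r ≤ n,
    StandardizesTo (fun u : Fin r => (σ ⟨i + u, by have := u.isLt; omega⟩ : ℕ)) p

/-- The number of occurrences of the consecutive pattern `p` in `σ`. -/
noncomputable def occurrences {r n : ℕ} (p : Equiv.Perm (Fin r)) (σ : Equiv.Perm (Fin n)) : ℕ :=
  Nat.card {i : ℕ // OccursAt p σ i}

/-- The number of permutations of length `n` with exactly `k` occurrences of `p`. -/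
noncomputable def permCount {r : ℕ} (p : Equiv.Perm (Fin r)) (n k : ℕ) : ℕ :=
  Nat.card {σ : Equiv.Perm (Fin n) // occurrences p σ = k}

/-- Two patterns are equivalent if for all `n` and all `0 ≤ k < n` equally many permutations of
length `n` have `k` occurrences of the one and of the other. -/
def PatternEquivalent {r s : ℕ} (p : Equiv.Perm (Fin r)) (q : Equiv.Perm (Fin s)) : Prop :=
  ∀ n k : ℕ, k < n → permCount p n k = permCount q n k

/-- The generating function `∑ π_{n,k} (x ^ n / n!) t ^ k`, as a formal power series in `x` with
coefficients in `ℚ⟦t⟧`. -/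
noncomputable def occurrenceSeries {r : ℕ} (p : Equiv.Perm (Fin r)) : ℚ⟦X⟧⟦X⟧ :=
  PowerSeries.mk fun n => PowerSeries.mk fun k => (permCount p n k : ℚ) / (n.factorial : ℚ)

/-- The `q`-clusters relative to the single pattern `p`: permutations `σ` of any length `n` with
`q ≥ 1` marked occurrences of `p`, listed from left to right, such that adjacent marked occurrences
overlap, the first one is at the beginning of `σ` and the last one at the end. -/
structure Cluster {r : ℕ} (p : Equiv.Perm (Fin r)) (q : ℕ) where
  n : ℕ
  σ : Equiv.Perm (Fin n)
  pos : Fin q → ℕ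
  q_pos : 0 < q
  occurs : ∀ k, OccursAt p σ (pos k)
  increasing : ∀ k l : Fin q, (k : ℕ) + 1 = l → pos k < pos l
  linked : ∀ k l : Fin q, (k : ℕ) + 1 = l → pos l < pos k + r
  starts : ∀ k : Fin q, (k : ℕ) = 0 → pos k = 0
  finishes : ∀ k : Fin q, (k : ℕ) + 1 = q → n = pos k + r

/-- The word `1 2 … a τ (a+1)` of length `m + 1`, where `τ` is a permutation of the numbers
`a + 2, …, m + 1`. With everything numbered from `0`, this is `0, …, a - 1`, then
`a + 1 + τ 0, …, a + 1 + τ (m - a - 1)`, then `a`. -/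
def riseWord {a m : ℕ} (h : a < m) (τ : Equiv.Perm (Fin (m - a))) (i : Fin (m + 1)) :
    Fin (m + 1) :=
  if (i : ℕ) < a then i
  else if hm : (i : ℕ) < m then
    ⟨a + 1 + τ ⟨(i : ℕ) - a, by omega⟩, by
      have := (τ ⟨(i : ℕ) - a, by omega⟩).isLt
      omega⟩
  else ⟨a, by omega⟩

theorem riseWord_injective {a m : ℕ} (h : a < m) (τ : Equiv.Perm (Fin (m - a))) :
    Function.Injective (riseWord h τ) := by
  intro i j hij
  have hi := i.isLt
  have hj := j.isLt
  unfold riseWord at hij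
  apply Fin.ext
  split_ifs at hij <;> simp only [Fin.ext_iff] at hij <;> try omega
  have h1 := τ.injective (Fin.ext (Nat.add_left_cancel hij))
  simp only [Fin.mk.injEq] at h1
  omega

/-- The pattern `1 2 … a τ (a+1)` as a permutation of length `m + 1`. -/
noncomputable def risePattern {a m : ℕ} (h : a < m) (τ : Equiv.Perm (Fin (m - a))) :
    Equiv.Perm (Fin (m + 1)) :=
  Equiv.ofBijective (riseWord h τ) (Finite.injective_iff_bijective.mp (riseWord_injective h τ))

/-- The product `∏_{j=1}^k binom (j m - a) (m - a)`. -/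
def binomProduct (a m k : ℕ) : ℕ :=
  ∏ j ∈ Finset.Icc 1 k, (j * m - a).choose (m - a)

/-- The formal power series `∑_{k ≥ 1} ((t-1)^k x^(km+1) / (km+1)!) ∏_{j=1}^k binom (jm-a) (m-a)`
in `x` with coefficients in `ℚ⟦t⟧`, for `m ≥ 1`: its coefficient at `x ^ n` collects the terms with
`k m + 1 = n` (which forces `k ≤ n`). -/
noncomputable def clusterTail (a m : ℕ) : ℚ⟦X⟧⟦X⟧ :=
  PowerSeries.mk fun n => ∑ k ∈ Finset.Icc 1 n with k * m + 1 = n,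
    PowerSeries.C ((binomProduct a m k : ℚ) / ((k * m + 1).factorial : ℚ)) *
      (PowerSeries.X - 1) ^ k

/-! Everything rests on one property of the pattern (`nonOverlapping_risePattern`): two occurrences
share at most one entry. Hence adjacent marked occurrences in a cluster share exactly one, and a
`k`-cluster is just a permutation of length `k m + 1` in which the pattern occurs at `0, m, …, (k -
1) m`, here called chained.

Chained permutations are counted by removing the first `m` entries (`chainCount_risePattern_succ`).
What remains is chained and begins with its own minimum. An occurrence at `0` fixes the order of the
removed entries and forces that minimum to be the value `a`; so the removed set contains all values
below `a`, omits `a`, and takes its other `m - a` elements freely from the `(k + 1) m - a` values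
above `a`.

For the generating function, `t ^ occ` is expanded by writing `t = 1 + (t - 1)` at the occurrences
of the initial chain only (`X_pow_occurrences`). Each term splits into a chained prefix and an
arbitrary suffix. Summation over permutations gives a binomial convolution, which says `Π = 1 + Π C`
with `C` the series of chains. The chain of length one contributes `x`, the others the sum in the
theorem. As `C` does not depend on `τ`, neither does `Π`. -/

/-! ### Splitting a permutation into a prefix and a suffix -/

/-- The permutation of `Fin (a + b)` whose first `a` entries form the set `A` and are ordered like
`ρ`, and whose last `b` entries are ordered like `ρ'`. -/
def splitPerm {a b : ℕ} (A : {A : Finset (Fin (a + b)) // A.card = a}) (ρ : Equiv.Perm (Fin a))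
    (ρ' : Equiv.Perm (Fin b)) : Equiv.Perm (Fin (a + b)) :=
  finSumFinEquiv.symm.trans ((Equiv.sumCongr ρ ρ').trans
    (finSumEquivOfFinset A.2
      (by rw [Finset.card_compl, A.2, Fintype.card_fin, Nat.add_sub_cancel_left])))

section Split

variable {a b : ℕ} (A : {A : Finset (Fin (a + b)) // A.card = a}) (ρ : Equiv.Perm (Fin a))
  (ρ' : Equiv.Perm (Fin b))

theorem card_compl_of_card_eq : (A.1ᶜ).card = b := by
  rw [Finset.card_compl, A.2, Fintype.card_fin, Nat.add_sub_cancel_left]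

theorem splitPerm_castAdd (i : Fin a) :
    splitPerm A ρ ρ' (Fin.castAdd b i) = A.1.orderEmbOfFin A.2 (ρ i) := by
  simp [splitPerm]

theorem splitPerm_natAdd (i : Fin b) :
    splitPerm A ρ ρ' (Fin.natAdd a i) =
      A.1ᶜ.orderEmbOfFin (card_compl_of_card_eq A) (ρ' i) := by
  simp [splitPerm]

theorem splitPerm_castAdd_mem (i : Fin a) : splitPerm A ρ ρ' (Fin.castAdd b i) ∈ A.1 := by
  rw [splitPerm_castAdd]
  exact Finset.orderEmbOfFin_mem _ _ _

theorem splitPerm_natAdd_mem (i : Fin b) : splitPerm A ρ ρ' (Fin.natAdd a i) ∈ A.1ᶜ := by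
  rw [splitPerm_natAdd]
  exact Finset.orderEmbOfFin_mem _ _ _

theorem mem_iff_exists_splitPerm (x : Fin (a + b)) :
    x ∈ A.1 ↔ ∃ i, splitPerm A ρ ρ' (Fin.castAdd b i) = x := by
  constructor
  · intro hx
    obtain ⟨y, rfl⟩ := (splitPerm A ρ ρ').surjective x
    induction y using Fin.addCases with
    | left i => exact ⟨i, rfl⟩
    | right i => exact absurd hx (Finset.mem_compl.mp (splitPerm_natAdd_mem A ρ ρ' i))
  · rintro ⟨i, rfl⟩
    exact splitPerm_castAdd_mem A ρ ρ' i

end Split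

/-- `A` is recovered as the set of values of the prefix, then `ρ` and `ρ'` as the orders of the two
parts; surjectivity follows from `(a + b).choose a * a! * b! = (a + b)!`. -/
theorem splitPerm_bijective (a b : ℕ) :
    Function.Bijective (fun x : {A : Finset (Fin (a + b)) // A.card = a} ×
      Equiv.Perm (Fin a) × Equiv.Perm (Fin b) => splitPerm x.1 x.2.1 x.2.2) := by
  rw [Fintype.bijective_iff_injective_and_card]
  constructor
  · rintro ⟨A, ρ, ρ'⟩ ⟨B, η, η'⟩ h
    dsimp only at h
    have hAB : A = B := by
      apply Subtype.ext
      ext x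
      rw [mem_iff_exists_splitPerm A ρ ρ', mem_iff_exists_splitPerm B η η', h]
    subst hAB
    have h1 : ρ = η := by
      ext i
      have := congrArg (fun σ => σ (Fin.castAdd b i)) h
      simp only [splitPerm_castAdd, EmbeddingLike.apply_eq_iff_eq] at this
      rw [this]
    have h2 : ρ' = η' := by
      ext i
      have := congrArg (fun σ => σ (Fin.natAdd a i)) h
      simp only [splitPerm_natAdd, EmbeddingLike.apply_eq_iff_eq] at this
      rw [this]
    rw [h1, h2]
  · rw [Fintype.card_prod, Fintype.card_prod, Fintype.card_finset_len, Fintype.card_perm,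
      Fintype.card_perm, Fintype.card_perm, Fintype.card_fin, Fintype.card_fin, Fintype.card_fin,
      ← mul_assoc, Nat.choose_symm_add, Nat.add_choose_mul_factorial_mul_factorial]

theorem sum_perm_eq_sum_splitPerm {M : Type*} [AddCommMonoid M] {a b : ℕ}
    (F : Equiv.Perm (Fin (a + b)) → M) :
    ∑ σ, F σ = ∑ x : {A : Finset (Fin (a + b)) // A.card = a} ×
      Equiv.Perm (Fin a) × Equiv.Perm (Fin b), F (splitPerm x.1 x.2.1 x.2.2) :=
  ((splitPerm_bijective a b).sum_comp F).symm

/-- The summand is blind to the value set `A`, so the choice of `A` contributes only the binomial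
factor: the product rule of exponential generating functions. -/
theorem sum_perm_of_splitPerm {R : Type*} [CommSemiring R] {a b : ℕ}
    (F : Equiv.Perm (Fin (a + b)) → R) (G : Equiv.Perm (Fin a) → R) (H : Equiv.Perm (Fin b) → R)
    (h : ∀ A ρ ρ', F (splitPerm A ρ ρ') = G ρ * H ρ') :
    ∑ σ, F σ = ((a + b).choose a : R) * ((∑ ρ, G ρ) * ∑ ρ', H ρ') := by
  rw [sum_perm_eq_sum_splitPerm]
  simp_rw [h, Fintype.sum_prod_type]
  rw [Finset.sum_const, Finset.card_univ, Fintype.card_finset_len, Fintype.card_fin, nsmul_eq_mul,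
    Finset.sum_mul_sum]

/-! ### Occurrences inside the prefix and the suffix -/

section Occurrences

variable {r : ℕ} (p : Equiv.Perm (Fin r))

theorem occursAt_splitPerm_left {a b : ℕ} (A : {A : Finset (Fin (a + b)) // A.card = a})
    (ρ : Equiv.Perm (Fin a)) (ρ' : Equiv.Perm (Fin b)) {i : ℕ} (hi : i + r ≤ a) :
    OccursAt p (splitPerm A ρ ρ') i ↔ OccursAt p ρ i := by
  have key : ∀ u : Fin r, splitPerm A ρ ρ' ⟨i + u, by omega⟩ =
      A.1.orderEmbOfFin A.2 (ρ ⟨i + u, by omega⟩) := fun u =>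
    splitPerm_castAdd A ρ ρ' ⟨i + u, by omega⟩
  constructor
  · rintro ⟨h, hs⟩
    refine ⟨hi, fun u v => ?_⟩
    rw [← hs u v]
    simp only [key, Fin.val_fin_lt, OrderEmbedding.lt_iff_lt]
  · rintro ⟨h, hs⟩
    refine ⟨by omega, fun u v => ?_⟩
    rw [← hs u v]
    simp only [key, Fin.val_fin_lt, OrderEmbedding.lt_iff_lt]

theorem occursAt_splitPerm_right {a b : ℕ} (A : {A : Finset (Fin (a + b)) // A.card = a})
    (ρ : Equiv.Perm (Fin a)) (ρ' : Equiv.Perm (Fin b)) (i : ℕ) :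
    OccursAt p (splitPerm A ρ ρ') (a + i) ↔ OccursAt p ρ' i := by
  have key : ∀ (hi : i + r ≤ b) (u : Fin r), splitPerm A ρ ρ' ⟨a + i + u, by omega⟩ =
      A.1ᶜ.orderEmbOfFin (card_compl_of_card_eq A) (ρ' ⟨i + u, by omega⟩) := fun hi u => by
    rw [← splitPerm_natAdd A ρ ρ']
    congr 1
    exact Fin.ext (Nat.add_assoc _ _ _)
  constructor
  · rintro ⟨h, hs⟩
    have hi : i + r ≤ b := by omega
    refine ⟨hi, fun u v => ?_⟩
    rw [← hs u v]
    simp only [key hi, Fin.val_fin_lt, OrderEmbedding.lt_iff_lt]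
  · rintro ⟨hi, hs⟩
    refine ⟨by omega, fun u v => ?_⟩
    rw [← hs u v]
    simp only [key hi, Fin.val_fin_lt, OrderEmbedding.lt_iff_lt]

/-- The number of occurrences of `p` in `σ` at positions from `j` on. -/
noncomputable def occurrencesFrom {n : ℕ} (σ : Equiv.Perm (Fin n)) (j : ℕ) : ℕ :=
  {i : ℕ | j ≤ i ∧ OccursAt p σ i}.ncard

theorem occurrencesFrom_zero {n : ℕ} (σ : Equiv.Perm (Fin n)) :
    occurrencesFrom p σ 0 = occurrences p σ := by
  simp only [occurrencesFrom, occurrences, Nat.zero_le, true_and]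
  rfl

theorem finite_occursAt {n : ℕ} (σ : Equiv.Perm (Fin n)) (j : ℕ) :
    {i : ℕ | j ≤ i ∧ OccursAt p σ i}.Finite :=
  (Set.finite_Iic n).subset fun i ⟨_, h, _⟩ => by
    simp only [Set.mem_Iic]
    omega

theorem occurrencesFrom_of_occursAt {n : ℕ} {σ : Equiv.Perm (Fin n)} {j : ℕ}
    (h : OccursAt p σ j) : occurrencesFrom p σ j = occurrencesFrom p σ (j + 1) + 1 := by
  unfold occurrencesFrom
  rw [← Set.ncard_insert_of_notMem (a := j) (by simp) (finite_occursAt p σ (j + 1))]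
  congr 1
  ext i
  simp only [Set.mem_ofPred_eq, Set.mem_insert_iff]
  constructor
  · rintro ⟨h1, h2⟩
    rcases h1.eq_or_lt with h3 | h3
    · exact Or.inl h3.symm
    · exact Or.inr ⟨h3, h2⟩
  · rintro (rfl | ⟨h1, h2⟩)
    · exact ⟨le_rfl, h⟩
    · exact ⟨by omega, h2⟩

theorem occurrencesFrom_congr {n : ℕ} {σ : Equiv.Perm (Fin n)} {j l : ℕ} (hjl : j ≤ l)
    (h : ∀ i, j ≤ i → i < l → ¬ OccursAt p σ i) :
    occurrencesFrom p σ j = occurrencesFrom p σ l := by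
  unfold occurrencesFrom
  congr 1
  ext i
  simp only [Set.mem_ofPred_eq]
  constructor
  · rintro ⟨h1, h2⟩
    exact ⟨not_lt.mp fun h3 => h i h1 h3 h2, h2⟩
  · rintro ⟨h1, h2⟩
    exact ⟨by omega, h2⟩

theorem occurrencesFrom_splitPerm {a b : ℕ} (A : {A : Finset (Fin (a + b)) // A.card = a})
    (ρ : Equiv.Perm (Fin a)) (ρ' : Equiv.Perm (Fin b)) :
    occurrencesFrom p (splitPerm A ρ ρ') a = occurrences p ρ' := by
  rw [← occurrencesFrom_zero, occurrencesFrom, occurrencesFrom,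
    ← Set.ncard_image_of_injective {i | 0 ≤ i ∧ OccursAt p ρ' i} (add_right_injective a)]
  congr 1
  ext i
  simp only [Set.mem_ofPred_eq, Set.mem_image, Nat.zero_le, true_and]
  constructor
  · rintro ⟨h1, h2⟩
    obtain ⟨j, rfl⟩ := Nat.exists_eq_add_of_le h1
    exact ⟨j, (occursAt_splitPerm_right p A ρ ρ' j).mp h2, rfl⟩
  · rintro ⟨j, h, rfl⟩
    exact ⟨by omega, (occursAt_splitPerm_right p A ρ ρ' j).mpr h⟩

end Occurrences

/-! ### Generating function of a non-overlapping pattern -/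

/-- The pattern `p` occurs in `σ` at the first `k` multiples of `m`. -/
def IsChained {r n : ℕ} (p : Equiv.Perm (Fin r)) (m k : ℕ) (σ : Equiv.Perm (Fin n)) : Prop :=
  ∀ j < k, OccursAt p σ (j * m)

/-- The number of permutations of length `k m + 1` in which `p` occurs at the first `k` multiples
of `m`. -/
noncomputable def chainCount {r : ℕ} (p : Equiv.Perm (Fin r)) (m k : ℕ) : ℕ :=
  Nat.card {σ : Equiv.Perm (Fin (k * m + 1)) // IsChained p m k σ}

/-- The generating polynomial, as a power series, of the permutations of length `n` by the number
of occurrences of `p`. -/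
noncomputable def occurrenceSum {r : ℕ} (p : Equiv.Perm (Fin r)) (n : ℕ) : ℚ⟦X⟧ :=
  ∑ σ : Equiv.Perm (Fin n), PowerSeries.X ^ occurrences p σ

theorem coeff_occurrenceSum {r : ℕ} (p : Equiv.Perm (Fin r)) (n k : ℕ) :
    PowerSeries.coeff k (occurrenceSum p n) = (permCount p n k : ℚ) := by
  classical
  simp only [occurrenceSum, map_sum, PowerSeries.coeff_X_pow, permCount]
  rw [Finset.sum_boole, Nat.card_eq_fintype_card, Fintype.card_subtype]
  simp only [eq_comm]

theorem coeff_occurrenceSeries {r : ℕ} (p : Equiv.Perm (Fin r)) (n : ℕ) :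
    PowerSeries.coeff n (occurrenceSeries p) =
      PowerSeries.C (1 / (n.factorial : ℚ)) * occurrenceSum p n := by
  ext k
  rw [PowerSeries.coeff_C_mul, coeff_occurrenceSum, occurrenceSeries, PowerSeries.coeff_mk,
    PowerSeries.coeff_mk]
  ring

open Classical in
theorem sum_isChained_eq_chainCount {R : Type*} [CommSemiring R] {r : ℕ} (p : Equiv.Perm (Fin r))
    (m k : ℕ) :
    ∑ σ : Equiv.Perm (Fin (k * m + 1)), (if IsChained p m k σ then (1 : R) else 0) =
      chainCount p m k := by
  rw [Finset.sum_boole, chainCount, Nat.card_eq_fintype_card, Fintype.card_subtype]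

/-- Two occurrences of `p` in a permutation share at most one entry, where `p` has length
`m + 1`. -/
def NonOverlapping {m : ℕ} (p : Equiv.Perm (Fin (m + 1))) : Prop :=
  ∀ (n : ℕ) (σ : Equiv.Perm (Fin n)) (i j : ℕ), i < j → j < i + m →
    OccursAt p σ i → ¬ OccursAt p σ j

section Telescope

variable {m : ℕ} {p : Equiv.Perm (Fin (m + 1))}

-- If the chain extends by an occurrence at `k * m`, its factor `X` is split as `1 + (X - 1)`. In
-- the `X - 1` part the count may restart at `(k + 1) * m`, because no occurrence starts strictly
-- between.
open Classical in
theorem chained_step (hm : 1 ≤ m) (hp : NonOverlapping p) {n : ℕ} (σ : Equiv.Perm (Fin n))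
    (k : ℕ) :
    (if IsChained p m k σ then (1 : ℚ⟦X⟧) else 0) * PowerSeries.X ^ occurrencesFrom p σ (k * m) =
      (if IsChained p m k σ then 1 else 0) * PowerSeries.X ^ occurrencesFrom p σ (k * m + 1) +
        (PowerSeries.X - 1) * ((if IsChained p m (k + 1) σ then 1 else 0) *
          PowerSeries.X ^ occurrencesFrom p σ ((k + 1) * m)) := by
  have hsucc : IsChained p m (k + 1) σ ↔ IsChained p m k σ ∧ OccursAt p σ (k * m) := by
    simp only [IsChained, Nat.lt_succ_iff_lt_or_eq, or_imp, forall_and, forall_eq]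
  by_cases hk : IsChained p m k σ
  · by_cases ho : OccursAt p σ (k * m)
    · rw [if_pos hk, if_pos (hsucc.mpr ⟨hk, ho⟩), occurrencesFrom_of_occursAt p ho,
        occurrencesFrom_congr p (j := k * m + 1) (l := (k + 1) * m) (by rw [add_mul]; omega)
          (fun i h1 h2 => hp n σ _ i h1 (by rw [add_mul] at h2; omega) ho)]
      ring
    · rw [if_pos hk, if_neg fun h => ho (hsucc.mp h).2,
        occurrencesFrom_congr p (j := k * m) (l := k * m + 1) (by omega)
          (fun i h1 h2 => by rwa [show i = k * m by omega])]
      ring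
  · rw [if_neg hk, if_neg fun h => hk (hsucc.mp h).1]
    ring

open Classical in
theorem X_pow_occurrences (hm : 1 ≤ m) (hp : NonOverlapping p) {n : ℕ} (σ : Equiv.Perm (Fin n))
    (K : ℕ) :
    (PowerSeries.X : ℚ⟦X⟧) ^ occurrences p σ =
      ∑ k ∈ Finset.range K, (PowerSeries.X - 1) ^ k * ((if IsChained p m k σ then 1 else 0) *
          PowerSeries.X ^ occurrencesFrom p σ (k * m + 1)) +
        (PowerSeries.X - 1) ^ K * ((if IsChained p m K σ then 1 else 0) *
          PowerSeries.X ^ occurrencesFrom p σ (K * m)) := by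
  induction K with
  | zero =>
    have h0 : IsChained p m 0 σ := fun j hj => absurd hj (Nat.not_lt_zero j)
    rw [if_pos h0, zero_mul, occurrencesFrom_zero]
    simp
  | succ K ih =>
    rw [ih, Finset.sum_range_succ, chained_step hm hp σ K]
    ring

theorem IsChained.length_le {k n : ℕ} {σ : Equiv.Perm (Fin n)} (h : IsChained p m k σ)
    (hn : 1 ≤ n) : k * m + 1 ≤ n := by
  cases k with
  | zero => omega
  | succ k =>
    obtain ⟨h1, -⟩ := h k (Nat.lt_succ_self k)
    rw [add_mul]
    omega

-- Being chained depends only on the prefix of length `k * m + 1`, and the occurrences counted lie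
-- wholly in the suffix.
open Classical in
theorem sum_isChained_mul (k b : ℕ) :
    ∑ σ : Equiv.Perm (Fin (k * m + 1 + b)), (if IsChained p m k σ then (1 : ℚ⟦X⟧) else 0) *
        PowerSeries.X ^ occurrencesFrom p σ (k * m + 1) =
      ((k * m + 1 + b).choose (k * m + 1) : ℚ⟦X⟧) *
        ((chainCount p m k : ℚ⟦X⟧) * occurrenceSum p b) := by
  rw [sum_perm_of_splitPerm _ (fun ρ => if IsChained p m k ρ then (1 : ℚ⟦X⟧) else 0)
    (fun ρ' => PowerSeries.X ^ occurrences p ρ'), sum_isChained_eq_chainCount, occurrenceSum]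
  intro A ρ ρ'
  rw [occurrencesFrom_splitPerm]
  congr 2
  apply propext
  refine forall₂_congr fun j hj => occursAt_splitPerm_left p A ρ ρ' ?_
  have := Nat.mul_le_mul_right m (Nat.succ_le_of_lt hj)
  rw [Nat.succ_mul] at this
  omega

open Classical in
theorem occurrenceSum_recurrence (hm : 1 ≤ m) (hp : NonOverlapping p) {n : ℕ} (hn : 1 ≤ n) :
    occurrenceSum p n = ∑ k ∈ Finset.range n with k * m + 1 ≤ n,
      (PowerSeries.X - 1) ^ k * ((n.choose (k * m + 1) : ℚ⟦X⟧) *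
        ((chainCount p m k : ℚ⟦X⟧) * occurrenceSum p (n - (k * m + 1)))) := by
  have hzero : ∀ (k : ℕ), ¬ k * m + 1 ≤ n → ∀ σ : Equiv.Perm (Fin n), ¬ IsChained p m k σ :=
    fun k hk σ h => hk (h.length_le hn)
  -- Expanding to depth `n` kills the remainder: a chain of `n` occurrences needs more than `n`
  -- entries.
  have hnm : ¬ n * m + 1 ≤ n := by
    have := Nat.mul_le_mul_left n hm
    omega
  conv_lhs => rw [occurrenceSum]
  simp_rw [fun σ : Equiv.Perm (Fin n) => X_pow_occurrences hm hp σ n, if_neg (hzero n hnm _),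
    zero_mul, mul_zero, add_zero]
  rw [Finset.sum_comm, Finset.sum_filter]
  refine Finset.sum_congr rfl fun k _ => ?_
  rw [← Finset.mul_sum]
  split_ifs with h
  · obtain ⟨b, rfl⟩ := Nat.exists_eq_add_of_le h
    rw [sum_isChained_mul, Nat.add_sub_cancel_left]
  · simp [if_neg (hzero k h _)]

/-- The cluster generating function, including the trivial cluster of length `1`. -/
noncomputable def chainSeries (p : Equiv.Perm (Fin (m + 1))) : ℚ⟦X⟧⟦X⟧ :=
  PowerSeries.mk fun n => ∑ k ∈ Finset.range n with k * m + 1 = n,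
    PowerSeries.C ((chainCount p m k : ℚ) / ((k * m + 1).factorial : ℚ)) *
      (PowerSeries.X - 1) ^ k

theorem occurrenceSum_zero : occurrenceSum p 0 = 1 := by
  have h : ∀ σ : Equiv.Perm (Fin 0), occurrences p σ = 0 := fun σ => by
    have : IsEmpty {i : ℕ // OccursAt p σ i} := ⟨fun ⟨i, h, _⟩ => by omega⟩
    exact Nat.card_of_isEmpty
  simp [occurrenceSum, h]

/-- Divided by `n!`, the recurrence is the coefficient of `x ^ n` in `Π = 1 + Π C`; the constant
term supplies the `1`. -/
theorem occurrenceSeries_mul_one_sub (hm : 1 ≤ m) (hp : NonOverlapping p) :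
    occurrenceSeries p * (1 - chainSeries p) = 1 := by
  rw [mul_sub, mul_one, sub_eq_iff_eq_add]
  ext1 n
  rcases Nat.eq_zero_or_pos n with rfl | hn
  · rw [map_add, PowerSeries.coeff_mul, coeff_occurrenceSeries, occurrenceSum_zero]
    simp [chainSeries]
  rw [map_add, PowerSeries.coeff_one, if_neg hn.ne', zero_add, PowerSeries.coeff_mul,
    Finset.Nat.sum_antidiagonal_eq_sum_range_succ_mk]
  have hC : ∀ c : ℕ, (c : ℚ⟦X⟧) = PowerSeries.C (c : ℚ) := fun c => by simp
  rw [coeff_occurrenceSeries, occurrenceSum_recurrence hm hp hn, Finset.mul_sum]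
  symm
  -- After reflection the outer index is the length of the chained prefix, hence determined by `k`
  -- as `k * m + 1`.
  rw [← Finset.sum_range_reflect]
  simp only [chainSeries, PowerSeries.coeff_mk, Finset.mul_sum]
  rw [Finset.sum_sigma']
  refine Finset.sum_bij' (fun x _ => x.2) (fun k _ => ⟨k * m + 1, k⟩) ?_ ?_ ?_ ?_ ?_
  · rintro ⟨i, k⟩ h
    simp only [Finset.mem_sigma, Finset.mem_range, Finset.mem_filter] at h ⊢
    omega
  · intro k h
    simp only [Finset.mem_sigma, Finset.mem_range, Finset.mem_filter] at h ⊢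
    have := Nat.mul_le_mul_left k hm
    omega
  · rintro ⟨i, k⟩ h
    simp only [Finset.mem_sigma, Finset.mem_range, Finset.mem_filter] at h
    obtain rfl : i = k * m + 1 := by omega
    rfl
  · intro k h
    rfl
  · rintro ⟨i, k⟩ h
    simp only [Finset.mem_sigma, Finset.mem_range, Finset.mem_filter] at h
    obtain rfl : i = k * m + 1 := by omega
    have hi : n.succ - 1 - (k * m + 1) = n - (k * m + 1) := by omega
    simp only [hi]
    rw [coeff_occurrenceSeries, hC, hC]
    have hkn : k * m + 1 ≤ n := by omega
    have hq : 1 / ((n - (k * m + 1)).factorial : ℚ) *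
        ((chainCount p m k : ℚ) / ((k * m + 1).factorial : ℚ)) =
        1 / (n.factorial : ℚ) * (n.choose (k * m + 1) : ℚ) * (chainCount p m k : ℚ) := by
      rw [Nat.cast_choose ℚ hkn]
      have := Nat.factorial_ne_zero n
      field_simp
    calc _ = PowerSeries.C (1 / ((n - (k * m + 1)).factorial : ℚ) *
        ((chainCount p m k : ℚ) / ((k * m + 1).factorial : ℚ))) *
          (occurrenceSum p (n - (k * m + 1)) * (PowerSeries.X - 1) ^ k) := by
          rw [map_mul]
          ring
      _ = _ := by
          rw [hq, map_mul, map_mul]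
          ring

end Telescope

/-! ### Order relations in the pattern and in its chains -/

theorem OccursAt.lt_iff {r n : ℕ} {p : Equiv.Perm (Fin r)} {σ : Equiv.Perm (Fin n)} {i x y : ℕ}
    (h : OccursAt p σ i) (hx : i ≤ x) (hy : i ≤ y) (hxr : x < i + r) (hyr : y < i + r)
    (hxn : x < n) (hyn : y < n) :
    σ ⟨x, hxn⟩ < σ ⟨y, hyn⟩ ↔ p ⟨x - i, by omega⟩ < p ⟨y - i, by omega⟩ := by
  obtain ⟨h, hs⟩ := h
  rw [← hs]
  simp only [Nat.add_sub_cancel' hx, Nat.add_sub_cancel' hy, Fin.val_fin_lt]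

section Rise

variable {a m : ℕ} (h : a < m) (τ : Equiv.Perm (Fin (m - a)))

theorem risePattern_val_of_lt {u : ℕ} (hu : u < a) :
    (risePattern h τ ⟨u, by omega⟩ : ℕ) = u := by
  simp [risePattern, riseWord, hu]

theorem risePattern_val_of_le {u : ℕ} (hu : a ≤ u) (hum : u < m) :
    (risePattern h τ ⟨u, by omega⟩ : ℕ) = a + 1 + τ ⟨u - a, by omega⟩ := by
  simp [risePattern, riseWord, hum, not_lt.mpr hu]

theorem risePattern_val_last : (risePattern h τ ⟨m, by omega⟩ : ℕ) = a := by
  simp [risePattern, riseWord, not_lt.mpr h.le]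

theorem risePattern_lt {u v : ℕ} (huv : u < v) (hv : v < m + 1) (hu : u < a) :
    risePattern h τ ⟨u, by omega⟩ < risePattern h τ ⟨v, hv⟩ := by
  rw [Fin.lt_def, risePattern_val_of_lt h τ hu]
  rcases lt_or_ge v a with h1 | h1
  · rwa [risePattern_val_of_lt h τ h1]
  · rcases Nat.lt_succ_iff_lt_or_eq.mp hv with h2 | rfl
    · rw [risePattern_val_of_le h τ h1 h2]
      omega
    · rwa [risePattern_val_last h τ]

theorem risePattern_last_lt {u : ℕ} (hu : a ≤ u) (hum : u < m) :
    risePattern h τ ⟨m, by omega⟩ < risePattern h τ ⟨u, by omega⟩ := by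
  rw [Fin.lt_def, risePattern_val_of_le h τ hu hum, risePattern_val_last h τ]
  omega

/-- If two occurrences shared more than one entry, some entry would be among the first `a` of the
second and in the `τ` part of the first. The last entry of the first occurrence would then be both
larger and smaller than it. -/
theorem nonOverlapping_risePattern (ha : 1 ≤ a) : NonOverlapping (risePattern h τ) := by
  intro n σ i j hij hji hi hj
  have hn := hj.1
  obtain ⟨d, rfl⟩ := Nat.exists_eq_add_of_lt hij
  -- The shift is `d + 1`. This `u` is below `a`, keeps `d + 1 + u` below `m`, and makes `d + 1 + u`
  -- at least `a`, whichever term attains the minimum.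
  set u := min a (m - (d + 1)) - 1 with hu
  have h1 := (hj.lt_iff (x := i + d + 1 + u) (y := i + m) (by omega) (by omega) (by omega)
    (by omega) (by omega) (by omega)).mpr (risePattern_lt h τ (by omega) _ (by omega))
  have h2 := (hi.lt_iff (x := i + m) (y := i + d + 1 + u) (by omega) (by omega) (by omega)
    (by omega) (by omega) (by omega)).mpr (by
      simpa using risePattern_last_lt h τ (u := i + d + 1 + u - i) (by omega) (by omega))
  exact lt_asymm h1 h2

/-- As `a ≥ 1`, each occurrence begins with its smallest entry; consecutive ones share an endpoint,
so the inequalities propagate along the chain. -/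
theorem IsChained.apply_zero_le (ha : 1 ≤ a) {k n : ℕ} {σ : Equiv.Perm (Fin n)}
    (hσ : IsChained (risePattern h τ) m k σ) {x : ℕ} (hx : x ≤ k * m) (hxn : x < n) :
    σ ⟨0, by omega⟩ ≤ σ ⟨x, hxn⟩ := by
  induction k generalizing x with
  | zero =>
    obtain rfl : x = 0 := by omega
    exact le_rfl
  | succ k ih =>
    have hσ' : IsChained (risePattern h τ) m k σ := fun j hj => hσ j (by omega)
    rcases le_or_gt x (k * m) with h1 | h1
    · exact ih hσ' h1 hxn
    · rw [add_mul, one_mul] at hx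
      refine (ih hσ' le_rfl (by omega)).trans ?_
      refine (((hσ k (by omega)).lt_iff (x := k * m) (y := x) (by omega) (by omega) (by omega)
        (by omega) (by omega) (by omega)).mpr ?_).le
      exact risePattern_lt h τ (by omega) _ (by omega)

theorem IsChained.apply_zero (ha : 1 ≤ a) {k : ℕ} {σ : Equiv.Perm (Fin (k * m + 1))}
    (hσ : IsChained (risePattern h τ) m k σ) : σ 0 = 0 := by
  obtain ⟨y, hy⟩ := σ.surjective 0
  have := hσ.apply_zero_le h τ ha (x := y) (by omega) y.isLt
  rw [Fin.eta, hy] at this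
  exact Fin.le_zero_iff.mp this

/-- The word `1 2 … a τ`, numbered from `0`. -/
def riseHeadWord (i : Fin m) : Fin m :=
  if hi : (i : ℕ) < a then i
  else ⟨a + τ ⟨(i : ℕ) - a, by omega⟩, by
    have := (τ ⟨(i : ℕ) - a, by omega⟩).isLt
    omega⟩

/-- Deleting the last letter of the pattern leaves a gap at the value `a`; lowering the larger
letters by one closes it. -/
theorem riseHeadWord_val (i : Fin m) : (riseHeadWord h τ i : ℕ) =
    if (risePattern h τ i.castSucc : ℕ) < a then (risePattern h τ i.castSucc : ℕ)
    else (risePattern h τ i.castSucc : ℕ) - 1 := by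
  have hc : i.castSucc = ⟨i, by omega⟩ := rfl
  rw [hc, riseHeadWord]
  rcases lt_or_ge (i : ℕ) a with hi | hi
  · rw [risePattern_val_of_lt h τ hi, dif_pos hi, if_pos hi]
  · rw [risePattern_val_of_le h τ hi i.isLt, dif_neg (by omega), if_neg (by omega)]
    dsimp only
    omega

theorem risePattern_castSucc_ne (i : Fin m) : (risePattern h τ i.castSucc : ℕ) ≠ a := by
  intro hi
  have : risePattern h τ i.castSucc = risePattern h τ ⟨m, by omega⟩ :=
    Fin.ext (hi.trans (risePattern_val_last h τ).symm)
  have h1 := congrArg Fin.val ((risePattern h τ).injective this)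
  have := i.isLt
  simp only [Fin.val_castSucc] at h1
  omega

theorem riseHeadWord_lt_iff (i j : Fin m) : riseHeadWord h τ i < riseHeadWord h τ j ↔
    risePattern h τ i.castSucc < risePattern h τ j.castSucc := by
  have h1 := risePattern_castSucc_ne h τ i
  have h2 := risePattern_castSucc_ne h τ j
  rw [Fin.lt_def, Fin.lt_def, riseHeadWord_val, riseHeadWord_val]
  split_ifs <;> omega

theorem riseHeadWord_injective : Function.Injective (riseHeadWord h τ) := by
  intro i j hij
  apply Fin.castSucc_injective m
  apply (risePattern h τ).injective
  have h1 := riseHeadWord_lt_iff h τ i j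
  have h2 := riseHeadWord_lt_iff h τ j i
  rw [hij] at h1 h2
  exact le_antisymm (not_lt.mp fun h => lt_irrefl _ (h2.mpr h))
    (not_lt.mp fun h => lt_irrefl _ (h1.mpr h))

/-- The pattern `1 2 … a τ` as a permutation of length `m`. -/
noncomputable def riseHead : Equiv.Perm (Fin m) :=
  Equiv.ofBijective (riseHeadWord h τ)
    (Finite.injective_iff_bijective.mp (riseHeadWord_injective h τ))

theorem riseHead_lt_iff (i j : Fin m) : riseHead h τ i < riseHead h τ j ↔
    risePattern h τ i.castSucc < risePattern h τ j.castSucc :=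
  riseHeadWord_lt_iff h τ i j

theorem riseHead_val_lt_iff (i : Fin m) :
    (riseHead h τ i : ℕ) < a ↔ (i : ℕ) < a := by
  change (riseHeadWord h τ i : ℕ) < a ↔ _
  rw [riseHeadWord]
  split_ifs with hi
  · rfl
  · simp [hi]

theorem risePattern_castSucc_lt_last_iff (i : Fin m) :
    risePattern h τ i.castSucc < risePattern h τ (Fin.last m) ↔ (i : ℕ) < a := by
  constructor
  · intro hi
    by_contra h1
    exact lt_asymm hi (risePattern_last_lt h τ (not_lt.mp h1) i.isLt)
  · intro hi
    exact risePattern_lt h τ i.isLt (by omega) hi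

theorem risePattern_last_lt_castSucc_iff (i : Fin m) :
    risePattern h τ (Fin.last m) < risePattern h τ i.castSucc ↔ a ≤ (i : ℕ) := by
  constructor
  · intro hi
    by_contra h1
    exact lt_asymm hi (risePattern_lt h τ i.isLt (by omega) (not_le.mp h1))
  · intro hi
    exact risePattern_last_lt h τ hi i.isLt

end Rise

/-! ### Counting chained permutations -/

theorem Equiv.Perm.eq_of_lt_iff {n : ℕ} {ρ η : Equiv.Perm (Fin n)}
    (h : ∀ i j, ρ i < ρ j ↔ η i < η j) : ρ = η := by
  have hmono : StrictMono (fun x => ρ (η.symm x)) := fun x y hxy => by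
    simpa [h] using hxy
  have : (fun x => ρ (η.symm x)) = id := by
    refine (hmono.range_inj strictMono_id).mp ?_
    rw [Set.range_id]
    exact (η.symm.trans ρ).surjective.range_eq
  ext i
  have := congrFun this (η i)
  simp only [Equiv.symm_apply_apply, id] at this
  rw [this]

/-- Such a set is the initial segment below `c` together with any `m - c` of the `N - 1 - c`
elements above `c`. -/
theorem card_finset_initial {N m : ℕ} (c : Fin N) (hc : (c : ℕ) ≤ m) :
    Nat.card {A : {A : Finset (Fin N) // A.card = m} // Finset.Iio c ⊆ A.1 ∧ c ∉ A.1} =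
      (N - 1 - c).choose (m - c) := by
  rw [← Fin.card_Ioi, ← Finset.card_powersetCard,
    Nat.card_congr (Equiv.subtypeSubtypeEquivSubtypeInter (fun A : Finset (Fin N) => A.card = m)
      (fun A => Finset.Iio c ⊆ A ∧ c ∉ A)), Nat.card_eq_fintype_card, Fintype.card_subtype]
  refine Finset.card_nbij' (fun A => A \ Finset.Iio c) (fun B => B ∪ Finset.Iio c) ?_ ?_ ?_ ?_
  · intro A hA
    simp only [Finset.coe_filter, Finset.mem_univ, true_and, Set.mem_ofPred_eq] at hA
    obtain ⟨h1, h2, h3⟩ := hA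
    rw [Finset.mem_coe, Finset.mem_powersetCard, Finset.card_sdiff_of_subset h2, h1, Fin.card_Iio]
    refine ⟨fun x hx => ?_, rfl⟩
    rw [Finset.mem_sdiff, Finset.mem_Iio, not_lt] at hx
    rw [Finset.mem_Ioi]
    exact lt_of_le_of_ne hx.2 fun h => h3 (h ▸ hx.1)
  · intro B hB
    rw [Finset.mem_coe, Finset.mem_powersetCard] at hB
    simp only [Finset.coe_filter, Finset.mem_univ, true_and, Set.mem_ofPred_eq]
    refine ⟨?_, Finset.subset_union_right, ?_⟩
    · rw [Finset.card_union_of_disjoint, hB.2, Fin.card_Iio, Nat.sub_add_cancel hc]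
      rw [Finset.disjoint_left]
      intro x hx hx'
      exact lt_asymm (Finset.mem_Ioi.mp (hB.1 hx)) (Finset.mem_Iio.mp hx')
    · rw [Finset.mem_union, Finset.mem_Iio]
      rintro (h | h)
      · exact lt_irrefl _ (Finset.mem_Ioi.mp (hB.1 h))
      · exact lt_irrefl _ h
  · intro A hA
    simp only [Finset.coe_filter, Finset.mem_univ, true_and, Set.mem_ofPred_eq] at hA
    exact Finset.sdiff_union_of_subset hA.2.1
  · intro B hB
    rw [Finset.mem_coe, Finset.mem_powersetCard] at hB
    refine Finset.union_sdiff_cancel_right ?_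
    rw [Finset.disjoint_left]
    intro x hx hx'
    exact lt_asymm (Finset.mem_Ioi.mp (hB.1 hx)) (Finset.mem_Iio.mp hx')

theorem le_orderEmbOfFin {N m : ℕ} {A : Finset (Fin N)} (hA : A.card = m) (i : Fin m) :
    (i : ℕ) ≤ A.orderEmbOfFin hA i := by
  obtain ⟨i, hi⟩ := i
  induction i with
  | zero => exact Nat.zero_le _
  | succ i ih =>
    have h1 := ih (by omega)
    have h2 : A.orderEmbOfFin hA ⟨i, by omega⟩ < A.orderEmbOfFin hA ⟨i + 1, hi⟩ := by
      simp
    rw [Fin.lt_def] at h2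
    simp only at h1 ⊢
    omega

theorem orderEmbOfFin_of_lt {N m : ℕ} {A : Finset (Fin N)} (hA : A.card = m) {c : Fin N}
    (hc : Finset.Iio c ⊆ A) (i : ℕ) (hi : i < m) (hic : i < c) :
    (A.orderEmbOfFin hA ⟨i, hi⟩ : ℕ) = i := by
  induction i using Nat.strong_induction_on with
  | _ i ih =>
    have hmem : (⟨i, by omega⟩ : Fin N) ∈ A := hc (Finset.mem_Iio.mpr hic)
    rw [← Finset.mem_coe, ← Finset.range_orderEmbOfFin A hA] at hmem
    obtain ⟨j, hj⟩ := hmem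
    have h1 := le_orderEmbOfFin hA j
    have h2 : (A.orderEmbOfFin hA j : ℕ) = i := congrArg Fin.val hj
    -- The value `i` has some rank `j ≤ i` in `A`; a smaller `j` is excluded because by induction
    -- rank `j` holds the value `j`.
    rcases (h2 ▸ h1 : (j : ℕ) ≤ i).lt_or_eq with h3 | h3
    · have := ih j h3 j.isLt (by omega)
      rw [Fin.eta] at this
      omega
    · obtain rfl : j = ⟨i, hi⟩ := Fin.ext h3
      exact h2

theorem orderEmbOfFin_lt_iff {N m : ℕ} {A : Finset (Fin N)} (hA : A.card = m) {c : Fin N}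
    (hc : Finset.Iio c ⊆ A) (i : Fin m) : A.orderEmbOfFin hA i < c ↔ (i : ℕ) < c := by
  rw [Fin.lt_def]
  constructor
  · exact (le_orderEmbOfFin hA i).trans_lt
  · intro hi
    rwa [orderEmbOfFin_of_lt hA hc i i.isLt hi]

theorem splitPerm_natAdd_zero_le {a b : ℕ} (A : {A : Finset (Fin (a + (b + 1))) // A.card = a})
    (ρ : Equiv.Perm (Fin a)) {ρ' : Equiv.Perm (Fin (b + 1))} (h0 : ρ' 0 = 0)
    {x : Fin (a + (b + 1))} (hx : x ∉ A.1) : splitPerm A ρ ρ' (Fin.natAdd a 0) ≤ x := by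
  have hx' : x ∈ (A.1ᶜ : Finset _) := Finset.mem_compl.mpr hx
  rw [← Finset.mem_coe, ← Finset.range_orderEmbOfFin _ (card_compl_of_card_eq A)] at hx'
  obtain ⟨j, rfl⟩ := hx'
  rw [splitPerm_natAdd, h0]
  simp

section Count

variable {a m : ℕ} (h : a < m) (τ : Equiv.Perm (Fin (m - a)))

/-- The last letter of the occurrence is the first entry `c` of the suffix, which is the minimum of
the complement of `A`. Exactly `a` prefix entries must lie below it, and all values below `c` belong
to `A`, so `c` has the value `a`. -/
theorem occursAt_zero_splitPerm_iff {b : ℕ} (A : {A : Finset (Fin (m + (b + 1))) // A.card = m})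
    (ρ : Equiv.Perm (Fin m)) {ρ' : Equiv.Perm (Fin (b + 1))} (h0 : ρ' 0 = 0) :
    OccursAt (risePattern h τ) (splitPerm A ρ ρ') 0 ↔
      (Finset.Iio (⟨a, by omega⟩ : Fin (m + (b + 1))) ⊆ A.1 ∧ ⟨a, by omega⟩ ∉ A.1) ∧
        ρ = riseHead h τ := by
  set c : Fin (m + (b + 1)) := splitPerm A ρ ρ' (Fin.natAdd m 0) with hc
  have hcA : c ∉ A.1 := Finset.mem_compl.mp (splitPerm_natAdd_mem A ρ ρ' 0)
  have hocc : OccursAt (risePattern h τ) (splitPerm A ρ ρ') 0 ↔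
      StandardizesTo (fun u : Fin (m + 1) =>
        (splitPerm A ρ ρ' ⟨u, by omega⟩ : ℕ)) (risePattern h τ) := by
    simp only [OccursAt, Nat.zero_add]
    exact ⟨fun ⟨_, h⟩ => h, fun h => ⟨by omega, h⟩⟩
  have hleft : ∀ u : Fin m, splitPerm A ρ ρ' ⟨u.castSucc, by simp; omega⟩ =
      A.1.orderEmbOfFin A.2 (ρ u) := fun u => splitPerm_castAdd A ρ ρ' u
  have hlast : splitPerm A ρ ρ' ⟨Fin.last m, by simp⟩ = c := rfl
  rw [hocc]
  constructor
  · intro hs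
    have hρ : ρ = riseHead h τ := by
      refine Equiv.Perm.eq_of_lt_iff fun i j => ?_
      have := hs i.castSucc j.castSucc
      simp only [hleft, Fin.val_fin_lt, OrderEmbedding.lt_iff_lt] at this
      rw [this, riseHead_lt_iff]
    refine ⟨?_, hρ⟩
    have hlt : ∀ u : Fin m, A.1.orderEmbOfFin A.2 (ρ u) < c ↔ (u : ℕ) < a := fun u => by
      have := hs u.castSucc (Fin.last m)
      simp only [hleft, hlast, Fin.val_fin_lt] at this
      rw [this, risePattern_castSucc_lt_last_iff]
    have hcA' : Finset.Iio c ⊆ A.1 := fun x hx => by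
      by_contra hxA
      exact not_le.mpr (Finset.mem_Iio.mp hx) (splitPerm_natAdd_zero_le A ρ h0 hxA)
    have hca : c = ⟨a, by omega⟩ := by
      apply Fin.ext
      have h1 : ∀ i : Fin m, (i : ℕ) < c ↔ (i : ℕ) < a := fun i => by
        rw [← orderEmbOfFin_lt_iff A.2 hcA' i]
        obtain ⟨u, rfl⟩ := ρ.surjective i
        rw [hlt u, hρ, riseHead_val_lt_iff]
      -- Testing rank `a` gives `c ≤ a`, and rank `a - 1` gives `a ≤ c`.
      have h2 : a < (c : ℕ) ↔ a < a := h1 ⟨a, h⟩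
      change (c : ℕ) = a
      rcases Nat.eq_zero_or_pos a with h3 | h3
      · omega
      · have h4 : a - 1 < (c : ℕ) ↔ a - 1 < a := h1 ⟨a - 1, by omega⟩
        omega
    rw [← hca]
    exact ⟨hcA', hcA⟩
  · rintro ⟨⟨h1, h2⟩, rfl⟩
    have hca : c = ⟨a, by omega⟩ := by
      refine le_antisymm (splitPerm_natAdd_zero_le A _ h0 h2) (not_lt.mp fun h3 => ?_)
      exact hcA (h1 (Finset.mem_Iio.mpr h3))
    have hlt : ∀ u : Fin m, A.1.orderEmbOfFin A.2 (riseHead h τ u) < c ↔ (u : ℕ) < a :=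
      fun u => by
        rw [hca, orderEmbOfFin_lt_iff A.2 h1, riseHead_val_lt_iff]
    have hgt : ∀ u : Fin m, c < A.1.orderEmbOfFin A.2 (riseHead h τ u) ↔ a ≤ (u : ℕ) :=
      fun u => by
        rw [← not_lt (a := (u : ℕ)), ← hlt u, not_lt, lt_iff_le_and_ne, and_iff_left]
        intro h3
        exact hcA (h3 ▸ Finset.orderEmbOfFin_mem _ _ _)
    intro u v
    induction u using Fin.lastCases with
    | last =>
      induction v using Fin.lastCases with
      | last => simp
      | cast v =>
        simp only [hleft, hlast, Fin.val_fin_lt]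
        rw [hgt, risePattern_last_lt_castSucc_iff]
    | cast u =>
      induction v using Fin.lastCases with
      | last =>
        simp only [hleft, hlast, Fin.val_fin_lt]
        rw [hlt, risePattern_castSucc_lt_last_iff]
      | cast v =>
        simp only [hleft, Fin.val_fin_lt, OrderEmbedding.lt_iff_lt]
        rw [riseHead_lt_iff]

end Count

theorem chainCount_eq_of_length_eq {r : ℕ} (p : Equiv.Perm (Fin r)) {m k n : ℕ}
    (hn : k * m + 1 = n) :
    chainCount p m k = Nat.card {σ : Equiv.Perm (Fin n) // IsChained p m k σ} := by
  subst hn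
  rfl

theorem chainCount_zero {r : ℕ} (p : Equiv.Perm (Fin r)) (m : ℕ) : chainCount p m 0 = 1 := by
  rw [chainCount_eq_of_length_eq p (n := 1) (by omega), Nat.card_eq_one_iff_unique]
  exact ⟨inferInstance, ⟨1, fun j hj => absurd hj (Nat.not_lt_zero j)⟩⟩

theorem isChained_succ_splitPerm {r m b k : ℕ} (p : Equiv.Perm (Fin r))
    (A : {A : Finset (Fin (m + b)) // A.card = m}) (ρ : Equiv.Perm (Fin m))
    (ρ' : Equiv.Perm (Fin b)) :
    IsChained p m (k + 1) (splitPerm A ρ ρ') ↔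
      OccursAt p (splitPerm A ρ ρ') 0 ∧ IsChained p m k ρ' := by
  have key : ∀ j, OccursAt p (splitPerm A ρ ρ') ((j + 1) * m) ↔ OccursAt p ρ' (j * m) := fun j => by
    rw [← occursAt_splitPerm_right p A ρ ρ', add_mul, one_mul, add_comm (j * m)]
  constructor
  · intro hc
    refine ⟨by simpa using hc 0 (Nat.succ_pos k), fun j hj => ?_⟩
    exact (key j).mp (hc (j + 1) (Nat.succ_lt_succ hj))
  · rintro ⟨h0, hc⟩ (_ | j) hj
    · simpa using h0
    · exact (key j).mpr (hc j (Nat.succ_lt_succ_iff.mp hj))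

section Rise

variable {a m : ℕ} (h : a < m) (τ : Equiv.Perm (Fin (m - a)))

theorem chainCount_risePattern_succ (ha : 1 ≤ a) (k : ℕ) :
    chainCount (risePattern h τ) m (k + 1) =
      ((k + 1) * m - a).choose (m - a) * chainCount (risePattern h τ) m k := by
  set c : Fin (m + (k * m + 1)) := ⟨a, by omega⟩ with hc
  have e1 : {σ : Equiv.Perm (Fin (m + (k * m + 1))) //
        IsChained (risePattern h τ) m (k + 1) σ} ≃
      {x : {A : Finset (Fin (m + (k * m + 1))) // A.card = m} × Equiv.Perm (Fin m) ×
        Equiv.Perm (Fin (k * m + 1)) // (Finset.Iio c ⊆ x.1.1 ∧ c ∉ x.1.1) ∧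
          x.2.1 = riseHead h τ ∧ IsChained (risePattern h τ) m k x.2.2} := by
    refine (Equiv.subtypeEquiv (Equiv.ofBijective _ (splitPerm_bijective m (k * m + 1)))
      fun x => ?_).symm
    rw [Equiv.ofBijective_apply, isChained_succ_splitPerm, ← and_assoc]
    -- The characterization of an occurrence at `0` needs a suffix starting with its minimum, which
    -- holds because the suffix is chained.
    refine and_congr_left fun hx => ?_
    exact (occursAt_zero_splitPerm_iff h τ x.1 x.2.1 (hx.apply_zero h τ ha)).symm
  have e2 : {x : {A : Finset (Fin (m + (k * m + 1))) // A.card = m} × Equiv.Perm (Fin m) ×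
        Equiv.Perm (Fin (k * m + 1)) // (Finset.Iio c ⊆ x.1.1 ∧ c ∉ x.1.1) ∧
          x.2.1 = riseHead h τ ∧ IsChained (risePattern h τ) m k x.2.2} ≃
      {A : {A : Finset (Fin (m + (k * m + 1))) // A.card = m} //
        Finset.Iio c ⊆ A.1 ∧ c ∉ A.1} ×
      {σ : Equiv.Perm (Fin (k * m + 1)) // IsChained (risePattern h τ) m k σ} :=
    { toFun := fun x => (⟨x.1.1, x.2.1⟩, ⟨x.1.2.2, x.2.2.2⟩)
      invFun := fun y => ⟨(y.1.1, riseHead h τ, y.2.1), y.1.2, rfl, y.2.2⟩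
      left_inv := by
        rintro ⟨x, h1, h2, h3⟩
        exact Subtype.ext (Prod.ext rfl (Prod.ext h2.symm rfl))
      right_inv := fun _ => rfl }
  rw [chainCount_eq_of_length_eq _ (n := m + (k * m + 1)) (by rw [add_mul]; omega),
    Nat.card_congr (e1.trans e2), Nat.card_prod, card_finset_initial c h.le]
  have hN : m + (k * m + 1) - 1 - (c : ℕ) = (k + 1) * m - a := by
    rw [hc, add_mul, one_mul]
    simp only
    omega
  rw [hN]
  rfl

theorem chainCount_risePattern (ha : 1 ≤ a) (k : ℕ) :
    chainCount (risePattern h τ) m k = ∏ j ∈ Finset.Icc 1 k, (j * m - a).choose (m - a) := by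
  induction k with
  | zero => simp [chainCount_zero]
  | succ k ih =>
    rw [chainCount_risePattern_succ h τ ha, ih, Finset.prod_Icc_succ_top (by omega), mul_comm]

end Rise

/-! ### Clusters are chained permutations -/

section Clusters

variable {m : ℕ} {p : Equiv.Perm (Fin (m + 1))}

/-- Linking bounds each step between marked positions by `m`, as the pattern has length `m + 1`;
non-overlapping forbids smaller steps. -/
theorem Cluster.pos_eq (hp : NonOverlapping p) {k : ℕ} (c : Cluster p k) (i : ℕ) (hi : i < k) :
    c.pos ⟨i, hi⟩ = i * m := by
  induction i with
  | zero => rw [c.starts _ rfl, zero_mul]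
  | succ i ih =>
    have h1 := ih (by omega)
    have h2 := c.increasing ⟨i, by omega⟩ ⟨i + 1, hi⟩ rfl
    have h3 := c.linked ⟨i, by omega⟩ ⟨i + 1, hi⟩ rfl
    have h4 : ¬ c.pos ⟨i + 1, hi⟩ < c.pos ⟨i, by omega⟩ + m := fun h4 =>
      hp _ c.σ _ _ h2 h4 (c.occurs _) (c.occurs _)
    rw [add_mul]
    omega

theorem Cluster.length_eq (hp : NonOverlapping p) {k : ℕ} (c : Cluster p k) :
    c.n = k * m + 1 := by
  have hk := c.q_pos
  obtain ⟨k, rfl⟩ := Nat.exists_eq_succ_of_ne_zero hk.ne'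
  rw [c.finishes ⟨k, Nat.lt_succ_self k⟩ rfl, c.pos_eq hp, Nat.succ_mul]
  omega

/-- The cluster carried by a permutation in which `p` occurs at the first `k` multiples of `m`. -/
def IsChained.toCluster (hm : 1 ≤ m) {k : ℕ} (hk : 1 ≤ k) {σ : Equiv.Perm (Fin (k * m + 1))}
    (hσ : IsChained p m k σ) : Cluster p k where
  n := k * m + 1
  σ := σ
  pos := fun i => i * m
  q_pos := hk
  occurs := fun i => hσ i i.isLt
  increasing := fun i j hij => by
    rw [← hij, add_mul]
    omega
  linked := fun i j hij => by
    rw [← hij, add_mul]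
    omega
  starts := fun i hi => by rw [hi, zero_mul]
  finishes := fun i hi => by
    have := congrArg (· * m) hi
    simp only [add_mul] at this
    omega

theorem card_cluster_eq_chainCount (hm : 1 ≤ m) (hp : NonOverlapping p) {k : ℕ} (hk : 1 ≤ k) :
    Nat.card (Cluster p k) = chainCount p m k := by
  symm
  refine Nat.card_congr (Equiv.ofBijective (fun σ => σ.2.toCluster hm hk) ⟨?_, ?_⟩)
  · rintro ⟨σ, hσ⟩ ⟨σ', hσ'⟩ heq
    simp only [IsChained.toCluster, Cluster.mk.injEq, heq_eq_eq, true_and, and_true] at heq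
    exact Subtype.ext heq
  · intro c
    have hpos : c.pos = fun i : Fin k => (i : ℕ) * m := funext fun i => c.pos_eq hp i i.isLt
    have hn := c.length_eq hp
    obtain ⟨n, σ, pos, h1, h2, h3, h4, h5, h6⟩ := c
    dsimp only at hpos hn
    subst hpos hn
    exact ⟨⟨σ, fun j hj => h2 ⟨j, hj⟩⟩, rfl⟩

end Clusters

/-! ### The inverse series and equivalence -/

theorem chainSeries_risePattern {a m : ℕ} (ha : 1 ≤ a) (h : a < m)
    (τ : Equiv.Perm (Fin (m - a))) :
    chainSeries (risePattern h τ) = PowerSeries.X + clusterTail a m := by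
  ext1 n
  rw [map_add, chainSeries, clusterTail, PowerSeries.coeff_mk, PowerSeries.coeff_mk,
    PowerSeries.coeff_X]
  have hcount : ∀ k, chainCount (risePattern h τ) m k = binomProduct a m k :=
    chainCount_risePattern h τ ha
  simp only [hcount]
  have hm : ∀ k, k ≤ k * m := fun k => Nat.le_mul_of_pos_right k (by omega)
  -- The two index sets differ only by `k = 0`, present when `n = 1`: this is the term `X`.
  have hset : (Finset.range n).filter (fun k => k * m + 1 = n) =
      (if n = 1 then {0} else ∅) ∪ (Finset.Icc 1 n).filter (fun k => k * m + 1 = n) := by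
    ext k
    have := hm k
    rw [Finset.mem_union, Finset.mem_filter, Finset.mem_filter, Finset.mem_range,
      Finset.mem_Icc]
    rcases Nat.eq_zero_or_pos k with rfl | hk
    · split_ifs <;> simp <;> omega
    · have : k ∉ (if n = 1 then {0} else ∅ : Finset ℕ) := by
        split_ifs
        · simpa using hk.ne'
        · simp
      simp only [this, false_or]
      omega
  rw [hset, Finset.sum_union]
  · congr 1
    split_ifs
    · simp [binomProduct]
    · simp
  · rw [Finset.disjoint_left]
    intro k hk hk'
    rw [Finset.mem_filter, Finset.mem_Icc] at hk'
    split_ifs at hk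
    · rw [Finset.mem_singleton] at hk
      omega
    · simp at hk

theorem patternEquivalent_of_occurrenceSeries_eq {r s : ℕ} {p : Equiv.Perm (Fin r)}
    {q : Equiv.Perm (Fin s)} (h : occurrenceSeries p = occurrenceSeries q) :
    PatternEquivalent p q := by
  intro n k _
  have h1 := congrArg (fun f => PowerSeries.coeff k (PowerSeries.coeff n f)) h
  simp only [occurrenceSeries, PowerSeries.coeff_mk] at h1
  have h2 : (n.factorial : ℚ) ≠ 0 := by exact_mod_cast n.factorial_ne_zero
  rw [div_left_inj' h2] at h1
  exact_mod_cast h1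

theorem mainTheorem3 (a m : ℕ) (ha : 1 ≤ a) (ham : a < m) :
    (∀ (τ : Equiv.Perm (Fin (m - a))) (k : ℕ), 1 ≤ k →
      Nat.card (Cluster (risePattern ham τ) k) =
        ∏ j ∈ Finset.Icc 1 k, (j * m - a).choose (m - a)) ∧
    (∀ τ : Equiv.Perm (Fin (m - a)),
      occurrenceSeries (risePattern ham τ) * (1 - PowerSeries.X - clusterTail a m) = 1) ∧
    (∀ τ τ' : Equiv.Perm (Fin (m - a)),
      PatternEquivalent (risePattern ham τ) (risePattern ham τ')) := by
  have hm : 1 ≤ m := by omega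
  have hseries : ∀ τ : Equiv.Perm (Fin (m - a)),
      occurrenceSeries (risePattern ham τ) * (1 - PowerSeries.X - clusterTail a m) = 1 :=
    fun τ => by
      rw [sub_sub, ← chainSeries_risePattern ha ham τ]
      exact occurrenceSeries_mul_one_sub hm (nonOverlapping_risePattern ham τ ha)
  refine ⟨fun τ k hk => ?_, hseries, fun τ τ' => ?_⟩
  · rw [card_cluster_eq_chainCount hm (nonOverlapping_risePattern ham τ ha) hk,
      chainCount_risePattern ham τ ha]
  · apply patternEquivalent_of_occurrenceSeries_eq
    -- Both series are inverse to the same series, in which `τ` does not appear.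
    exact left_inv_eq_right_inv (hseries τ) (by rw [mul_comm, hseries τ'])
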